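/- An $n$-cell is a set that, in the subspace topology, is homeomorphic to the closed unit ball of $\mathbb{R}^n$; its boundary $\partial D$ is the subset corresponding to the unit sphere $S^{n-1}$ (a $0$-cell is a point, with empty boundary). A finite collection $W=\{D_i\}_{i\in I}$ of $n$-cells in a topological space is called an LCL (locally centered lump) collection if (LC) for every $J\subseteq I$ with $|J|\ge 2$ such that $D_i\cap D_k\neq\emptyset$ for all $i,k\in J$, one has $\bigcap_{i\in J}D_i\neq\emptyset$; and (LL) for every $J\subseteq I$ with $|J|=k\ge 2$ and $\bigcap_{i\in J}D_i\neq\emptyset$, one has $k\le n+1$, $\bigcap_{i\in J}D_i=\bigcap_{i\in J}\partial D_i$, and this set is an $(n+1-k)$-cell. Two collections $\{D_i\}_{i\in I}$ and $\{C_i\}_{i\in I}$ are isomorphic if for every non-empty finite $J\subseteq I$: $\bigcap_{i\in J}D_i\neq\emptyset$ if and only if $\bigcap_{i\in J}C_i\neq\emptyset$. Theorem 2.1. Let $n\ge 1$, let $W=\{D_0,D_1,\dots,D_s\}$ be an LCL collection of $n$-cells, and let $V=\{D_1,\dots,D_p\}$ be the collection of all members other than $D_0$ that intersect $D_0$. Put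 $C_i=D_0\cap D_i$ for $i=1,\dots,p$. Then $U=\{C_1,\dots,C_p\}$ is an LCL collection of $(n-1)$-cells, and the collections $V$ and $U$ are isomorphic (under $D_i\leftrightarrow C_i$). -/

import Mathlib

/-- `D` is an `n`-cell: with its subspace topology it is homeomorphic to the closed unit ball of
Euclidean `n`-space. (For `n = 0` the ball is a point.) -/
def IsCell {X : Type*} [TopologicalSpace X] (n : ℕ) (D : Set X) : Prop :=
  Nonempty (D ≃ₜ Metric.closedBall (0 : EuclideanSpace ℝ (Fin n)) 1)

/-- The boundary `∂D` of an `n`-cell `D`: the points that correspond to points of the unit sphere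
under a homeomorphism of `D` with the closed unit ball of Euclidean `n`-space. By invariance of
domain it does not matter which homeomorphism is used. (For `n = 0` the unit sphere is empty.) -/
def cellBoundary {X : Type*} [TopologicalSpace X] (n : ℕ) (D : Set X) : Set X :=
  {x | ∃ (hx : x ∈ D) (h : D ≃ₜ Metric.closedBall (0 : EuclideanSpace ℝ (Fin n)) 1),
    (h ⟨x, hx⟩ : EuclideanSpace ℝ (Fin n)) ∈ Metric.sphere (0 : EuclideanSpace ℝ (Fin n)) 1}

/-- Locally centered: any two or more members that meet pairwise have a common point. -/
def LocallyCentered {X ι : Type*} (D : ι → Set X) : Prop :=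
  ∀ J : Finset ι, 2 ≤ J.card → (∀ i ∈ J, ∀ k ∈ J, (D i ∩ D k).Nonempty) →
    (⋂ i ∈ J, D i).Nonempty

/-- Locally lump: whenever `k ≥ 2` distinct members have non-empty intersection, that
intersection equals the intersection of their boundaries and is an `(n + 1 - k)`-cell
(in particular `k ≤ n + 1`). -/
def LocallyLump {X ι : Type*} [TopologicalSpace X] (n : ℕ) (D : ι → Set X) : Prop :=
  ∀ J : Finset ι, 2 ≤ J.card → (⋂ i ∈ J, D i).Nonempty →
    (⋂ i ∈ J, D i) = (⋂ i ∈ J, cellBoundary n (D i)) ∧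
      ∃ m : ℕ, m + J.card = n + 1 ∧ IsCell m (⋂ i ∈ J, D i)

/-- A locally centered lump (LCL) collection of `n`-cells. -/
structure IsLCL {X ι : Type*} [TopologicalSpace X] (n : ℕ) (D : ι → Set X) : Prop where
  finite : Finite ι
  isCell : ∀ i, IsCell n (D i)
  locallyCentered : LocallyCentered D
  locallyLump : LocallyLump n D

/-- Two collections indexed by the same set are isomorphic (under the correspondence
`D i ↔ C i`) if they have the same intersection pattern. -/
def IsomorphicCollections {X Y ι : Type*} (D : ι → Set X) (C : ι → Set Y) : Prop :=
  ∀ J : Finset ι, J.Nonempty → ((⋂ i ∈ J, D i).Nonempty ↔ (⋂ i ∈ J, C i).Nonempty)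

/-- The indices of the members, other than `D i₀` itself, that meet `D i₀`. -/
abbrev MeetingIndex {X ι : Type*} (D : ι → Set X) (i₀ : ι) : Type _ :=
  {i : ι // i ≠ i₀ ∧ (D i₀ ∩ D i).Nonempty}

/-!
Write `C i = D i₀ ∩ D i`. That the sets `C i` are cells of dimension `n - 1`, that they are locally
centered, that their intersections are cells of the right dimension and that their intersection
pattern is that of the `D i` all follow by applying the hypotheses on `D` to an index set enlarged
by `i₀`, since `⋂ i ∈ J, C i = ⋂ i ∈ insert i₀ J, D i`.

What has content is that two distinct members `C i`, `C j` can only meet in boundary points. Both are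
`(n - 1)`-cells contained in the boundary sphere of `D i₀`. If a common point `x` were interior
to `C i`, then by invariance of domain `C i` would be a neighbourhood of `x` in that sphere
(`mem_nhdsWithin_cellBoundary`), so `C i ∩ C j` would be a neighbourhood of `x` in the
`(n - 1)`-cell `C j`. But `C i ∩ C j` is an `(n - 2)`-cell, which is impossible by invariance of
dimension (`not_mem_nhdsWithin_of_isCell`). Invariance of domain also shows that the boundary of a
cell does not depend on the parametrization (`norm_eq_one_of_mem_cellBoundary`).

Invariance of domain (`isOpen_image_of_continuousOn_injOn`) is deduced from Brouwer's fixed point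
theorem (`exists_eq_zero_of_norm_sub_le_one`) by perturbing a continuous extension of the inverse
map. Brouwer's theorem is deduced by smooth approximation from the `C¹` no-retraction theorem
(`not_contDiff_retraction_sphere`), which is proved by the Milnor–Rogers volume argument.
-/

open Set Metric MeasureTheory Polynomial Module
open scoped NNReal

/-! ### The no-retraction theorem -/

section Brouwer

variable {E : Type*} [NormedAddCommGroup E] [InnerProductSpace ℝ E]

/-- Extension by zero of a Lipschitz function on the unit ball that vanishes on the unit sphere. -/
theorem exists_lipschitz_extension_zero {g : E → E} {K : ℝ≥0}
    (hg : LipschitzOnWith K g (closedBall 0 1)) (h0 : ∀ x, ‖x‖ = 1 → g x = 0) :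
    ∃ g' : E → E, LipschitzWith (2 * K) g' ∧ EqOn g' g (ball 0 1) ∧
      ∀ x, 1 ≤ ‖x‖ → g' x = 0 := by
  classical
  have key : ∀ x y : E, ‖x‖ < 1 → 1 ≤ ‖y‖ → ‖g x‖ ≤ 2 * K * ‖x - y‖ := by
    intro x y hx hy
    have hy0 : 0 < ‖y‖ := by linarith
    have hz : ‖(‖y‖⁻¹ • y)‖ = 1 := by
      rw [norm_smul, norm_inv, norm_norm, inv_mul_cancel₀ hy0.ne']
    have h1 : ‖g x - g (‖y‖⁻¹ • y)‖ ≤ K * ‖x - ‖y‖⁻¹ • y‖ :=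
      hg.norm_sub_le (by simpa using hx.le) (by simp [hz])
    rw [h0 _ hz, sub_zero] at h1
    have h2 : ‖y - ‖y‖⁻¹ • y‖ = ‖y‖ - 1 := by
      have : y - ‖y‖⁻¹ • y = (1 - ‖y‖⁻¹) • y := by rw [sub_smul, one_smul]
      rw [this, norm_smul, Real.norm_of_nonneg (sub_nonneg.2 (inv_le_one_of_one_le₀ hy)), sub_mul,
        inv_mul_cancel₀ hy0.ne', one_mul]
    have h3 : ‖x - ‖y‖⁻¹ • y‖ ≤ ‖x - y‖ + ‖y - ‖y‖⁻¹ • y‖ := norm_sub_le_norm_sub_add_norm_sub _ _ _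
    have h4 : ‖y‖ - ‖x‖ ≤ ‖x - y‖ := by rw [norm_sub_rev]; exact norm_sub_norm_le _ _
    have h5 : ‖x - ‖y‖⁻¹ • y‖ ≤ 2 * ‖x - y‖ := by linarith
    calc ‖g x‖ ≤ K * ‖x - ‖y‖⁻¹ • y‖ := h1
      _ ≤ K * (2 * ‖x - y‖) := by gcongr
      _ = _ := by ring
  refine ⟨fun x => if ‖x‖ < 1 then g x else 0, LipschitzWith.of_dist_le_mul fun x y => ?_,
    fun x hx => if_pos (by simpa using hx), fun x hx => if_neg (not_lt.2 hx)⟩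
  simp only [dist_eq_norm]
  push_cast
  by_cases hx : ‖x‖ < 1 <;> by_cases hy : ‖y‖ < 1 <;> simp only [hx, hy, if_true, if_false]
  · have := hg.norm_sub_le (x := x) (y := y) (by simpa using hx.le) (by simpa using hy.le)
    have h2 : 0 ≤ K * ‖x - y‖ := by positivity
    linarith
  · simpa using key x y hx (not_lt.1 hy)
  · simpa [norm_sub_rev] using key y x hy (not_lt.1 hx)
  · simp; positivity

variable [FiniteDimensional ℝ E]

/-- Along the line `t ↦ 1 + t • A` the determinant is a polynomial of degree at most `dim E`, so its
value at `t = 1` is recovered by Lagrange interpolation from any `dim E + 1` nodes. -/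
theorem det_one_add_eq_sum_lagrange (s : Finset ℝ) (hs : s.card = finrank ℝ E + 1)
    (A : E →L[ℝ] E) :
    (1 + A).det = ∑ t ∈ s, (1 + t • A).det * (Lagrange.basis s id t).eval 1 := by
  let b := finBasis ℝ E
  let M := LinearMap.toMatrix b b (A : E →ₗ[ℝ] E)
  let p : ℝ[X] := Matrix.det ((X : ℝ[X]) • M.map C + (1 : Matrix _ _ ℝ).map C)
  have hp (t : ℝ) : p.eval t = (1 + t • A).det := by
    have h1 : (1 + t • A).det = LinearMap.det ((LinearMap.id : E →ₗ[ℝ] E) + t • (A : E →ₗ[ℝ] E)) :=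
      rfl
    rw [h1, ← LinearMap.det_toMatrix b, ← coe_evalRingHom, RingHom.map_det]
    congr 1
    ext i j
    simp only [M, Matrix.map_apply, Matrix.add_apply, Matrix.smul_apply, RingHom.mapMatrix_apply,
      coe_evalRingHom, eval_C, eval_X, smul_eq_mul, eval_mul, map_add, map_smul,
      LinearMap.toMatrix_id]
    exact add_comm _ _
  have hdeg : p.degree < s.card := by
    refine (natDegree_le_iff_degree_le.1 (natDegree_det_X_add_C_le M 1)).trans_lt ?_
    rw [hs, Fintype.card_fin]
    exact_mod_cast Nat.lt_succ_self _
  have h := congrArg (eval 1)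
    (Lagrange.eq_interpolate (v := id) (s := s) (injOn_id _) hdeg)
  rw [Lagrange.interpolate_apply, eval_finsetSum, hp, one_smul] at h
  rw [h]
  exact Finset.sum_congr rfl fun t _ => by simp [hp]

/-- A small Lipschitz perturbation of the identity that is supported in the unit ball permutes the
unit ball. -/
theorem bijOn_ball_of_lipschitz_perturbation {g : E → E} {K : ℝ≥0} (hg : LipschitzWith K g)
    (h0 : ∀ x, 1 ≤ ‖x‖ → g x = 0) {t : ℝ≥0} (htK : t * K < 1) :
    BijOn (fun x => x + (t : ℝ) • g x) (ball 0 1) (ball 0 1) := by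
  have ht : (0 : ℝ) ≤ t := t.2
  have htK' : (t : ℝ) * K < 1 := by exact_mod_cast htK
  have hinj : Function.Injective (fun x => x + (t : ℝ) • g x) := by
    intro x y hxy
    have h1 : x - y = (t : ℝ) • (g y - g x) := by
      rw [smul_sub, sub_eq_sub_iff_add_eq_add]
      simpa [add_comm] using hxy
    have h2 : ‖x - y‖ ≤ t * (K * ‖x - y‖) := by
      conv_lhs => rw [h1, norm_smul, Real.norm_of_nonneg ht, norm_sub_rev]
      exact mul_le_mul_of_nonneg_left (hg.norm_sub_le x y) ht
    have h3 : ‖x - y‖ = 0 := by nlinarith [norm_nonneg (x - y)]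
    exact sub_eq_zero.1 (norm_eq_zero.1 h3)
  refine ⟨fun x hx => ?_, hinj.injOn, fun y hy => ?_⟩
  · by_contra hy
    simp only [mem_ball_zero_iff, not_lt] at hx hy
    -- a point outside the ball is fixed, so it can be the image of itself only
    have h1 := hinj (a₁ := x + (t : ℝ) • g x) (a₂ := x) (by simp [h0 _ hy])
    rw [h1] at hy
    exact absurd hx (not_lt.2 hy)
  · have hc : ContractingWith (t * K) (fun x => y - (t : ℝ) • g x) := by
      refine ⟨htK, LipschitzWith.of_dist_le_mul fun a b => ?_⟩
      rw [dist_eq_norm, sub_sub_sub_cancel_left, ← smul_sub, norm_smul, Real.norm_of_nonneg ht,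
        norm_sub_rev, dist_eq_norm]
      push_cast
      rw [mul_assoc]
      exact mul_le_mul_of_nonneg_left (hg.norm_sub_le a b) ht
    have hfix : y - (t : ℝ) • g (hc.fixedPoint _) = hc.fixedPoint _ := hc.fixedPoint_isFixedPt
    set x := hc.fixedPoint _
    have hx : x + (t : ℝ) • g x = y := (sub_eq_iff_eq_add.1 hfix).symm
    refine ⟨x, ?_, hx⟩
    by_contra hx1
    simp only [mem_ball_zero_iff, not_lt] at hx1 hy
    rw [h0 x hx1, smul_zero, add_zero] at hx
    rw [hx] at hx1
    linarith

/-- No-retraction theorem, for `C¹` maps. If `r` were a retraction of the ball onto the sphere, the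
volume of the image of the ball under `x ↦ x + t (r x - x)` would be polynomial in `t` and constant
for small `t`, hence equal to the volume of the ball for `t = 1`; but `r` has singular derivative
throughout the ball. -/
theorem not_contDiff_retraction_sphere {r : E → E} (hr : ContDiff ℝ 1 r)
    (hmaps : ∀ x, ‖r x‖ = 1) (hid : ∀ x, ‖x‖ = 1 → r x = x) : False := by
  let _ : MeasurableSpace E := borel E
  have _ : BorelSpace E := ⟨rfl⟩
  let A : E → E →L[ℝ] E := fun x => fderiv ℝ r x - 1
  have hAc : Continuous A := (hr.continuous_fderiv one_ne_zero).sub continuous_const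
  have hdetc (t : ℝ) : Continuous fun x => (1 + t • A x).det :=
    ContinuousLinearMap.continuous_det.comp (by fun_prop)
  have hsing (x : E) : (1 + A x).det = 0 := by
    have h1 : 1 + A x = fderiv ℝ r x := by simp [A]
    rw [h1]
    by_contra hdet
    have hu : IsUnit (LinearMap.det (fderiv ℝ r x : E →ₗ[ℝ] E)) := isUnit_iff_ne_zero.2 hdet
    obtain ⟨v, hv⟩ := (LinearMap.equivOfIsUnitDet hu).surjective (r x)
    have hv' : fderiv ℝ r x v = r x := by simpa using! hv
    have hd : HasFDerivAt r (fderiv ℝ r x) x :=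
      (hr.differentiable one_ne_zero x).hasFDerivAt
    -- differentiate `‖r x‖ ^ 2 = 1` in the direction `v`
    have h2 := hd.norm_sq
    have h3 : (fun y => ‖r y‖ ^ 2) = fun _ => (1 : ℝ) := by ext y; simp [hmaps]
    rw [h3] at h2
    have h4 := DFunLike.congr_fun (h2.unique (hasFDerivAt_const (1 : ℝ) x)) v
    simp [hv', hmaps] at h4
  obtain ⟨K, hK⟩ : ∃ K, LipschitzOnWith K (fun x => r x - x) (closedBall (0 : E) 1) :=
    (hr.sub contDiff_id).locallyLipschitz.locallyLipschitzOn.exists_lipschitzOnWith_of_compact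
      (isCompact_closedBall 0 1)
  obtain ⟨g, hgL, hgeq, hg0⟩ := exists_lipschitz_extension_zero hK
    (fun x hx => by simp [hid x hx])
  -- for small `t` the determinant is positive on the whole ball
  have hpos : ∀ᶠ t in nhds (0 : ℝ), ∀ x ∈ closedBall (0 : E) 1, 0 < (1 + t • A x).det := by
    refine (isCompact_closedBall (0 : E) 1).eventually_forall_of_forall_eventually fun x _ => ?_
    have hc : Continuous fun p : ℝ × E => (1 + p.1 • A p.2).det :=
      ContinuousLinearMap.continuous_det.comp (by fun_prop)
    refine (hc.tendsto (0, x)).eventually_const_lt ?_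
    have h1 : (1 + (0 : ℝ) • A x).det = LinearMap.det (LinearMap.id : E →ₗ[ℝ] E) := by
      rw [zero_smul, add_zero]
      rfl
    rw [h1, LinearMap.det_id]
    exact one_pos
  obtain ⟨ε₁, hε₁, hpos⟩ := Metric.eventually_nhds_iff.1 hpos
  obtain ⟨ε₂, hε₂, hsmall⟩ : ∃ ε₂ : ℝ, 0 < ε₂ ∧ ε₂ * (2 * K) < 1 := by
    refine ⟨(2 * K + 1)⁻¹, by positivity, ?_⟩
    rw [inv_mul_lt_iff₀ (by positivity)]
    simp
  have hvol : ∀ t ∈ Ioo 0 (min ε₁ ε₂),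
      ∫ x in ball (0 : E) 1, (1 + t • A x).det = volume.real (ball (0 : E) 1) := by
    rintro t ⟨ht0, ht⟩
    obtain ⟨ht1, ht2⟩ := lt_min_iff.1 ht
    lift t to ℝ≥0 using ht0.le
    have htK : t * (2 * K) < 1 := by
      rw [← NNReal.coe_lt_coe]
      push_cast
      refine lt_of_le_of_lt ?_ hsmall
      exact mul_le_mul_of_nonneg_right ht2.le (by positivity)
    have hbij : BijOn (fun x => x + (t : ℝ) • (r x - x)) (ball (0 : E) 1) (ball 0 1) :=
      (bijOn_ball_of_lipschitz_perturbation hgL hg0 htK).congr fun x hx => by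
        simp [hgeq hx]
    have hder (x : E) (_ : x ∈ ball (0 : E) 1) :
        HasFDerivWithinAt (fun x => x + (t : ℝ) • (r x - x)) (1 + (t : ℝ) • A x) (ball (0 : E) 1) x := by
      have hd : HasFDerivAt r (fderiv ℝ r x) x :=
        (hr.differentiable one_ne_zero x).hasFDerivAt
      exact ((hasFDerivAt_id x).add ((hd.sub (hasFDerivAt_id x)).const_smul (t : ℝ))).hasFDerivWithinAt
    have h := integral_image_eq_integral_abs_det_fderiv_smul volume measurableSet_ball hder
      hbij.injOn (fun _ => (1 : ℝ))
    rw [hbij.image_eq] at h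
    simp only [smul_eq_mul, mul_one, integral_const, measureReal_restrict_apply_univ] at h
    rw [h]
    refine setIntegral_congr_fun measurableSet_ball fun x hx => ?_
    exact (abs_of_pos (hpos (by simpa [abs_of_pos ht0] using ht1) x
      (ball_subset_closedBall hx))).symm
  obtain ⟨s, hs, hcard⟩ := (Ioo_infinite (lt_min hε₁ hε₂)).exists_subset_card_eq
    (finrank ℝ E + 1)
  have hint (t : ℝ) : IntegrableOn (fun x => (1 + t • A x).det) (ball (0 : E) 1) volume :=
    ((hdetc t).continuousOn.integrableOn_compact (isCompact_closedBall 0 1)).mono_set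
      ball_subset_closedBall
  have hsum : ∑ t ∈ s, (Lagrange.basis s id t).eval (1 : ℝ) = 1 := by
    rw [← eval_finsetSum, Lagrange.sum_basis (injOn_id _)
      (Finset.card_pos.1 (by rw [hcard]; exact Nat.succ_pos _)), eval_one]
  have hzero : ∫ x in ball (0 : E) 1, (1 + A x).det = volume.real (ball (0 : E) 1) := by
    rw [integral_congr_ae (.of_forall fun x => det_one_add_eq_sum_lagrange s hcard (A x))]
    rw [integral_finsetSum _ fun t _ => (hint t).mul_const _]
    simp_rw [integral_mul_const]
    rw [Finset.sum_congr rfl fun t ht => by rw [hvol t (hs ht)], ← Finset.mul_sum, hsum, mul_one]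
  simp only [hsing, integral_zero] at hzero
  exact (measureReal_ne_zero_iff (measure_ball_lt_top.ne)).2
    (measure_ball_pos volume 0 one_pos).ne' hzero.symm

/-! ### Brouwer's theorem -/

/-- A continuous self-map of `E` that is the identity far away has a zero: otherwise a smooth
approximation of it, normalised, would be a retraction of a ball onto its boundary sphere. -/
theorem exists_eq_zero_of_eq_id_of_le_norm {H : E → E} (hH : Continuous H) {R : ℝ}
    (hid : ∀ x, R ≤ ‖x‖ → H x = x) : ∃ x, H x = 0 := by
  by_contra! hne
  wlog hR : 1 ≤ R generalizing R
  · exact this (R := 1) (fun x hx => hid x (by linarith)) le_rfl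
  obtain ⟨K, hKs, hKd, -⟩ := hH.exists_contDiff_approx 1 (ε := fun x => ‖H x‖) hH.norm
    fun x => norm_pos_iff.2 (hne x)
  let χ : ContDiffBump (0 : E) := ⟨R, R + 1, by linarith, by linarith⟩
  let K' : E → E := fun x => x + χ x • (K x - x)
  have hK's : ContDiff ℝ 1 K' := contDiff_id.add ((χ.contDiff).smul (hKs.sub contDiff_id))
  have hK'H (x : E) : K' x = H x + χ x • (K x - H x) := by
    rcases le_total ‖x‖ R with h | h
    · have : χ x = 1 := χ.one_of_mem_closedBall (by simpa using h)
      simp [K', this]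
    · simp [K', hid x h]
  have hK'0 (x : E) : K' x ≠ 0 := by
    intro h0
    rw [hK'H, add_eq_zero_iff_eq_neg] at h0
    have h1 : ‖H x‖ = χ x * ‖K x - H x‖ := by
      rw [h0, norm_neg, norm_smul, Real.norm_of_nonneg χ.nonneg, ← h0]
    have h2 : ‖K x - H x‖ < ‖H x‖ := by simpa [dist_eq_norm] using hKd x
    have h3 := mul_le_of_le_one_left (norm_nonneg (K x - H x)) (χ.le_one (x := x))
    linarith
  have hK'id (x : E) (hx : R + 1 ≤ ‖x‖) : K' x = x := by
    have : χ x = 0 := χ.zero_of_le_dist (by simpa using hx)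
    simp [K', this]
  let L : E → E := fun x => K' ((R + 1) • x)
  have hLs : ContDiff ℝ 1 L := hK's.comp (contDiff_const_smul _)
  have hL0 (x : E) : ‖L x‖ ≠ 0 := norm_ne_zero_iff.2 (hK'0 _)
  refine not_contDiff_retraction_sphere (r := fun x => ‖L x‖⁻¹ • L x)
    (((hLs.norm ℝ fun x => hK'0 _).inv hL0).smul hLs) (fun x => ?_) (fun x hx => ?_)
  · rw [norm_smul, norm_inv, norm_norm, inv_mul_cancel₀ (hL0 x)]
  · have hn : ‖(R + 1) • x‖ = R + 1 := by
      rw [norm_smul, hx, mul_one, Real.norm_of_nonneg (by linarith)]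
    have hLx : L x = (R + 1) • x := hK'id _ hn.ge
    simp only [hLx, hn]
    rw [smul_smul, inv_mul_cancel₀ (by linarith), one_smul]

/-- A form of Brouwer's fixed point theorem: a continuous map on the unit ball that moves no point
by more than `1` has a zero. -/
theorem exists_eq_zero_of_norm_sub_le_one {H : E → E} (hH : ContinuousOn H (closedBall 0 1))
    (hd : ∀ x ∈ closedBall (0 : E) 1, ‖H x - x‖ ≤ 1) : ∃ x ∈ closedBall (0 : E) 1, H x = 0 := by
  by_contra! hne
  let m : E → ℝ := fun x => max 1 ‖x‖
  have hm (x : E) : 1 ≤ m x := le_max_left _ _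
  have hmc : Continuous m := by fun_prop
  let p : E → E := fun x => (m x)⁻¹ • x
  have hpc : Continuous p := (hmc.inv₀ fun x => by linarith [hm x]).smul continuous_id
  have hp (x : E) : p x ∈ closedBall (0 : E) 1 := by
    rw [mem_closedBall_zero_iff, norm_smul, norm_inv, Real.norm_of_nonneg (by linarith [hm x]),
      inv_mul_le_iff₀ (by linarith [hm x]), mul_one]
    exact le_max_right _ _
  -- interpolate between `H` on the unit sphere and the identity on the sphere of radius `2`
  let c : E → ℝ := fun x => min 1 (m x - 1)
  have hc0 (x : E) : 0 ≤ c x := le_min zero_le_one (by linarith [hm x])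
  have hc1 (x : E) : c x ≤ 1 := min_le_left _ _
  have hcc : Continuous c := by fun_prop
  have hHp : Continuous fun x => H (p x) := hH.comp_continuous hpc hp
  obtain ⟨x, hx⟩ := exists_eq_zero_of_eq_id_of_le_norm
    (H := fun x => (1 - c x) • H (p x) + c x • x) (R := 2)
    (((continuous_const.sub hcc).smul hHp).add (hcc.smul continuous_id)) fun x hx => by
      have : c x = 1 := min_eq_left (by linarith [le_max_right 1 ‖x‖])
      simp [this]
  rcases le_or_gt ‖x‖ 1 with h | h
  · have hmx : m x = 1 := max_eq_left h
    have hcx : c x = 0 := by simp [c, hmx]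
    have hpx : p x = x := by simp [p, hmx]
    exact hne x (by simpa using h) (by simpa [hcx, hpx] using hx)
  · have hmx : m x = ‖x‖ := max_eq_right h.le
    have hcx : 0 < c x := lt_min one_pos (by rw [hmx]; linarith)
    have hxp : x = ‖x‖ • p x := by
      simp only [p, hmx]
      rw [smul_smul, mul_inv_cancel₀ (by linarith), one_smul]
    have hpn : ‖p x‖ = 1 := by
      simp only [p, hmx]
      rw [norm_smul, norm_inv, norm_norm, inv_mul_cancel₀ (by linarith)]
    rcases (hc1 x).eq_or_lt with h1 | h1
    · simp only [h1, sub_self, zero_smul, one_smul, zero_add] at hx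
      rw [hx, norm_zero] at h
      linarith
    · -- here `H (p x)` is a negative multiple of `p x`, so it is at distance `> 1` from it
      have hneg : H (p x) = -((1 - c x)⁻¹ * (c x * ‖x‖)) • p x := by
        have h2 : (1 - c x) • H (p x) = -((c x * ‖x‖) • p x) := by
          rw [mul_smul, ← hxp]
          exact eq_neg_of_add_eq_zero_left hx
        rw [neg_smul, mul_smul, ← smul_neg, ← h2, smul_smul, inv_mul_cancel₀ (by linarith), one_smul]
      have h3 := hd _ (hp x)
      have h4 : 0 < (1 - c x)⁻¹ * (c x * ‖x‖) := by
        have := sub_pos.2 h1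
        positivity
      have h5 : H (p x) - p x = -((1 - c x)⁻¹ * (c x * ‖x‖) + 1) • p x := by
        rw [hneg]; module
      rw [h5, norm_smul, hpn, mul_one, norm_neg, Real.norm_of_nonneg (by linarith)] at h3
      linarith

end Brouwer

/-! ### Invariance of domain -/

section InvarianceOfDomain

variable {E : Type*} [NormedAddCommGroup E] [InnerProductSpace ℝ E]

/-- Pushing the points near `c` radially out to the sphere of radius `ε` around `c`. -/
theorem exists_continuousOn_push_out (c : E) {ε : ℝ} (hε : 0 < ε) :
    ∃ Φ : E → E, ContinuousOn Φ {c}ᶜ ∧ (∀ y, ε ≤ ‖y - c‖ → Φ y = y) ∧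
      ∀ y ≠ c, ‖y - c‖ ≤ ε → Φ y ∈ sphere c ε := by
  refine ⟨fun y => c + max (ε / ‖y - c‖) 1 • (y - c), ?_, fun y hy => ?_, fun y hy h => ?_⟩
  · have h1 : ContinuousOn (fun y : E => ‖y - c‖) {c}ᶜ := by fun_prop
    have h2 : ContinuousOn (fun y : E => ε / ‖y - c‖) {c}ᶜ :=
      continuousOn_const.div h1 fun y hy => norm_ne_zero_iff.2 (sub_ne_zero.2 hy)
    exact continuousOn_const.add ((h2.sup continuousOn_const).smul
      (continuousOn_id.sub continuousOn_const))
  · have : max (ε / ‖y - c‖) 1 = 1 := max_eq_right (div_le_one_of_le₀ hy (norm_nonneg _))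
    simp [this]
  · have h0 : 0 < ‖y - c‖ := norm_pos_iff.2 (sub_ne_zero.2 hy)
    have : max (ε / ‖y - c‖) 1 = ε / ‖y - c‖ := max_eq_left ((one_le_div h0).2 h)
    rw [mem_sphere_iff_norm]
    simp only [this, add_sub_cancel_left]
    rw [norm_smul, Real.norm_of_nonneg (by positivity), div_mul_cancel₀ _ h0.ne']

variable [FiniteDimensional ℝ E]

/-- The local form of invariance of domain. If `f 0` were not interior to the image `f '' B` of
the unit ball `B`, the inverse of `f` could be perturbed slightly to a map `f '' B → E` without
zeros: retract `f '' B` away from a point `c ∉ f '' B` close to `f 0`, and use that a smooth map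
sends small spheres around `c` to null sets. This contradicts Brouwer's theorem. -/
theorem mem_interior_image_unit_closedBall {f : E → E} (hf : ContinuousOn f (closedBall 0 1))
    (hinj : InjOn f (closedBall 0 1)) : f 0 ∈ interior (f '' closedBall 0 1) := by
  let _ : MeasurableSpace E := borel E
  have _ : BorelSpace E := ⟨rfl⟩
  set B : Set E := closedBall 0 1 with hB
  have hBc : IsCompact B := isCompact_closedBall 0 1
  have h0B : (0 : E) ∈ B := mem_closedBall_self zero_le_one
  have : CompactSpace B := isCompact_iff_compactSpace.1 hBc
  have hemb : Topology.IsClosedEmbedding (B.domRestrict f) :=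
    hf.domRestrict.isClosedEmbedding (injOn_iff_injective.1 hinj)
  obtain ⟨G₀, hG₀⟩ := ContinuousMap.exists_extension hemb (⟨Subtype.val, continuous_subtype_val⟩ : C(B, E))
  obtain ⟨G, hGc, hG⟩ : ∃ G : E → E, Continuous G ∧ ∀ x ∈ B, G (f x) = x :=
    ⟨G₀, G₀.continuous, fun x hx => DFunLike.congr_fun hG₀ ⟨x, hx⟩⟩
  by_contra hint
  obtain ⟨η, hη, hGη⟩ : ∃ η > 0, ∀ y, dist y (f 0) < η → ‖G y‖ < 1 / 4 := by
    have h1 : ∀ᶠ y in nhds (f 0), ‖G y‖ < 1 / 4 :=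
      (hGc.norm.tendsto (f 0)).eventually_lt_const (by rw [hG 0 h0B]; norm_num)
    exact Metric.eventually_nhds_iff.1 h1
  obtain ⟨ε, hε, hεη⟩ : ∃ ε > 0, 2 * ε < η := ⟨η / 3, by linarith, by linarith⟩
  obtain ⟨c, hcd, hcB⟩ : ∃ c, dist c (f 0) < ε ∧ c ∉ f '' B := by
    by_contra! h
    exact hint (mem_interior_iff_mem_nhds.2 (Filter.mem_of_superset (ball_mem_nhds _ hε)
      fun c hc => h c hc))
  have hnear (y : E) (hy : ‖y - c‖ ≤ ε) : ‖G y‖ < 1 / 4 := by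
    refine hGη y ?_
    have := dist_triangle y c (f 0)
    rw [dist_eq_norm y c] at this
    linarith
  obtain ⟨Φ, hΦc, hΦid, hΦs⟩ := exists_continuousOn_push_out c hε
  -- `G` vanishes on `f '' B` at `f 0` only, so it is bounded away from `0` off the `ε`-ball of `c`
  obtain ⟨δ, hδ, hδ1, hGδ⟩ : ∃ δ > 0, δ < 1 / 4 ∧
      ∀ y ∈ f '' B, ε ≤ ‖y - c‖ → 2 * δ ≤ ‖G y‖ := by
    have hcomp : IsCompact (f '' B ∩ {y | ε ≤ ‖y - c‖}) :=
      (hBc.image_of_continuousOn hf).inter_right (isClosed_le continuous_const (by fun_prop))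
    obtain ⟨a, ha, haG⟩ := hcomp.exists_forall_le' (f := fun y => ‖G y‖) (a := 0)
      hGc.norm.continuousOn (by
        rintro _ ⟨⟨x, hx, rfl⟩, hy⟩
        rw [hG x hx, norm_pos_iff]
        rintro rfl
        rw [mem_ofPred_eq, ← dist_eq_norm, dist_comm] at hy
        linarith)
    refine ⟨min (a / 2) (1 / 5), by positivity, ?_, fun y hy h => ?_⟩
    · exact (min_le_right _ _).trans_lt (by norm_num)
    · have := min_le_left (a / 2) (1 / 5)
      have := haG y ⟨hy, h⟩
      linarith
  obtain ⟨P, hPs, hPd, -⟩ := hGc.exists_contDiff_approx 1 (ε := fun _ => δ / 2)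
    continuous_const fun _ => by positivity
  have hnull : volume (P '' sphere c ε) = 0 :=
    addHaar_image_eq_zero_of_differentiableOn_of_addHaar_eq_zero _
      (hPs.differentiable one_ne_zero).differentiableOn
      (Measure.addHaar_sphere_of_ne_zero _ c hε.ne')
  obtain ⟨v, hvP, hv⟩ : ∃ v, v ∉ P '' sphere c ε ∧ ‖v‖ < δ / 2 := by
    by_contra! h
    have h1 : ball (0 : E) (δ / 2) ⊆ P '' sphere c ε := fun v hv => by
      by_contra hvP
      exact absurd (mem_ball_zero_iff.1 hv) (not_lt.2 (h v hvP))
    exact (measure_ball_pos volume (0 : E) (by positivity)).ne' (measure_mono_null h1 hnull)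
  have hPG (y : E) : ‖P y - v - G y‖ < δ := by
    have h1 : ‖P y - G y‖ < δ / 2 := by simpa [dist_eq_norm] using hPd y
    have h2 : P y - v - G y = (P y - G y) - v := by abel
    rw [h2]
    linarith [norm_sub_le (P y - G y) v]
  have hfc (x : E) (hx : x ∈ B) : f x ≠ c := fun h => hcB ⟨x, hx, h⟩
  obtain ⟨x, hx, hx0⟩ := exists_eq_zero_of_norm_sub_le_one (H := fun x => P (Φ (f x)) - v)
    ((hPs.continuous.comp_continuousOn (hΦc.comp hf hfc)).sub continuousOn_const) fun x hx => by
      rcases le_total ε ‖f x - c‖ with h | h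
      · have := hPG (f x)
        rw [hG x hx] at this
        rw [hΦid _ h]
        linarith
      · have h1 := hPG (Φ (f x))
        have h2 := hnear _ (mem_sphere_iff_norm.1 (hΦs _ (hfc x hx) h)).le
        have h3 := hnear _ h
        rw [hG x hx] at h3
        have h4 : P (Φ (f x)) - v - x = (P (Φ (f x)) - v - G (Φ (f x))) + G (Φ (f x)) - x := by abel
        rw [h4]
        linarith [norm_sub_le ((P (Φ (f x)) - v - G (Φ (f x))) + G (Φ (f x))) x,
          norm_add_le (P (Φ (f x)) - v - G (Φ (f x))) (G (Φ (f x)))]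
  rcases le_total ε ‖f x - c‖ with h | h
  · have h1 := hPG (f x)
    have h2 := hGδ _ ⟨x, hx, rfl⟩ h
    rw [hΦid _ h] at hx0
    rw [hx0, zero_sub, norm_neg] at h1
    linarith
  · exact hvP ⟨_, hΦs _ (hfc x hx) h, sub_eq_zero.1 hx0⟩

/-- **Invariance of domain**: an injective continuous map from an open subset of `E` to `E` is
open. -/
theorem isOpen_image_of_continuousOn_injOn {f : E → E} {U : Set E} (hU : IsOpen U)
    (hf : ContinuousOn f U) (hinj : InjOn f U) : IsOpen (f '' U) := by
  rw [isOpen_iff_mem_nhds]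
  rintro _ ⟨a, ha, rfl⟩
  obtain ⟨ρ, hρ, hρU⟩ := Metric.nhds_basis_closedBall.mem_iff.1 (hU.mem_nhds ha)
  let s : E → E := fun x => a + ρ • x
  have hs : MapsTo s (closedBall 0 1) (closedBall a ρ) := fun x hx => by
    rw [mem_closedBall_zero_iff] at hx
    simp only [s, mem_closedBall_iff_norm, add_sub_cancel_left, norm_smul,
      Real.norm_of_nonneg hρ.le]
    nlinarith
  have hsinj : Function.Injective s := fun x y h => by
    simpa [s, hρ.ne'] using h
  have h := mem_interior_image_unit_closedBall (f := f ∘ s)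
    ((hf.mono hρU).comp (by fun_prop) hs) ((hinj.mono hρU).comp hsinj.injOn hs)
  have hs0 : (f ∘ s) 0 = f a := by simp [s]
  rw [hs0] at h
  refine Filter.mem_of_superset (mem_interior_iff_mem_nhds.1 h) ?_
  rw [image_comp]
  exact image_mono (hs.image_subset.trans hρU)

end InvarianceOfDomain

/-! ### Invariance of domain in manifolds, invariance of dimension -/

section DomainCorollaries

variable {E : Type*} [NormedAddCommGroup E] [InnerProductSpace ℝ E] [FiniteDimensional ℝ E]

theorem isOpen_range_of_continuous_injective {U : Set E} (hU : IsOpen U) {φ : U → E}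
    (hφ : Continuous φ) (hinj : Function.Injective φ) : IsOpen (range φ) := by
  let f : E → E := Function.extend Subtype.val φ 0
  have hf (u : U) : f u = φ u := Subtype.val_injective.extend_apply φ 0 u
  have hfU : U.domRestrict f = φ := funext hf
  have himg : f '' U = range φ := by rw [← range_domRestrict, hfU]
  rw [← himg]
  refine isOpen_image_of_continuousOn_injOn hU ?_ ?_
  · rw [continuousOn_iff_continuous_domRestrict, hfU]
    exact hφ
  · rw [injOn_iff_injective, hfU]
    exact hinj

/-- Invariance of domain for maps into a manifold modelled on `E`. -/
theorem isOpen_range_of_chartedSpace {M : Type*} [TopologicalSpace M] [ChartedSpace E M]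
    {U : Set E} (hU : IsOpen U) {φ : U → M} (hφ : Continuous φ) (hinj : Function.Injective φ) :
    IsOpen (range φ) := by
  rw [isOpen_iff_mem_nhds]
  rintro _ ⟨u, rfl⟩
  let c := chartAt E (φ u)
  let V : Set E := Subtype.val '' (φ ⁻¹' c.source)
  have hVo : IsOpen V := hU.isOpenMap_subtype_val _ (c.open_source.preimage hφ)
  have hVU : V ⊆ U := Subtype.coe_image_subset _ _
  have hVc (v : V) : φ (inclusion hVU v) ∈ c.source := by
    obtain ⟨_, ⟨w, hw, rfl⟩⟩ := v
    exact hw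
  let ψ : V → E := fun v => c (φ (inclusion hVU v))
  have hψ : Continuous ψ :=
    c.continuousOn.comp_continuous (hφ.comp (continuous_inclusion hVU)) hVc
  have hψi : Function.Injective ψ := fun v w h =>
    inclusion_injective hVU (hinj (c.injOn (hVc v) (hVc w) h))
  have ho : IsOpen (c.symm '' range ψ) :=
    c.symm.isOpen_image_of_subset_source (isOpen_range_of_continuous_injective hVo hψ hψi) (by
      rintro _ ⟨v, rfl⟩
      exact c.map_source (hVc v))
  refine Filter.mem_of_superset (ho.mem_nhds ⟨c (φ u), ⟨⟨u, u, mem_chart_source E (φ u), rfl⟩, rfl⟩,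
    c.left_inv (mem_chart_source E (φ u))⟩) ?_
  rintro _ ⟨_, ⟨v, rfl⟩, rfl⟩
  exact ⟨inclusion hVU v, (c.left_inv (hVc v)).symm⟩

/-- Invariance of dimension. -/
theorem finrank_le_of_continuous_injective {F : Type*} [NormedAddCommGroup F]
    [InnerProductSpace ℝ F] [FiniteDimensional ℝ F] {U : Set E} (hU : IsOpen U)
    (hne : U.Nonempty) {φ : U → F} (hφ : Continuous φ) (hinj : Function.Injective φ) :
    finrank ℝ E ≤ finrank ℝ F := by
  by_contra! hlt
  obtain ⟨L, hL⟩ : ∃ L : F →ₗ[ℝ] E, Function.Injective L :=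
    Module.Free.exists_linearMap_injective_of_lift_rank_lt (by
      rw [← finrank_eq_rank, ← finrank_eq_rank, Cardinal.lift_natCast, Cardinal.lift_natCast]
      exact_mod_cast hlt)
  have ho : IsOpen (range (L ∘ φ)) := isOpen_range_of_continuous_injective hU
    (L.continuous_of_finiteDimensional.comp hφ) (hL.comp hinj)
  have htop : LinearMap.range L = ⊤ := by
    obtain ⟨u, hu⟩ := hne
    refine Submodule.eq_top_of_nonempty_interior' _ ⟨L (φ ⟨u, hu⟩), ?_⟩
    refine interior_maximal ?_ ho ⟨⟨u, hu⟩, rfl⟩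
    rintro _ ⟨v, rfl⟩
    exact ⟨φ v, rfl⟩
  have := LinearMap.finrank_range_le L
  rw [htop, finrank_top] at this
  exact absurd this (not_le.2 hlt)

end DomainCorollaries

/-! ### Cells and their boundaries -/

section Cells

variable {X : Type*} [TopologicalSpace X]

/-- The boundary of a cell can be read off from any parametrization of the cell. -/
theorem norm_eq_one_of_mem_cellBoundary {n : ℕ} {D : Set X} {x : X} (hx : x ∈ cellBoundary n D)
    (g : D ≃ₜ closedBall (0 : EuclideanSpace ℝ (Fin n)) 1) (hxD : x ∈ D) :
    ‖(g ⟨x, hxD⟩ : EuclideanSpace ℝ (Fin n))‖ = 1 := by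
  obtain ⟨_, h, hh⟩ := hx
  have hle : ‖(g ⟨x, hxD⟩ : EuclideanSpace ℝ (Fin n))‖ ≤ 1 := mem_closedBall_zero_iff.1 (g ⟨x, hxD⟩).2
  by_contra hne
  have hlt : (g ⟨x, hxD⟩ : EuclideanSpace ℝ (Fin n)) ∈ ball 0 1 := by
    simpa using lt_of_le_of_ne hle hne
  let φ : ball (0 : EuclideanSpace ℝ (Fin n)) 1 → EuclideanSpace ℝ (Fin n) :=
    fun u => h (g.symm (inclusion ball_subset_closedBall u))
  have ho : IsOpen (range φ) := isOpen_range_of_continuous_injective isOpen_ball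
    (by fun_prop) (Subtype.val_injective.comp (h.injective.comp (g.symm.injective.comp
      (inclusion_injective _))))
  have hsub : range φ ⊆ interior (closedBall 0 1) := interior_maximal (by
    rintro _ ⟨u, rfl⟩
    exact (h _).2) ho
  rw [interior_closedBall _ one_ne_zero] at hsub
  have h1 := hsub ⟨⟨_, hlt⟩, rfl⟩
  have h2 : φ ⟨_, hlt⟩ = h ⟨x, hxD⟩ := by
    simp only [φ]
    exact congrArg (fun y => (h y : EuclideanSpace ℝ (Fin n))) (g.symm_apply_apply ⟨x, hxD⟩)
  rw [h2, mem_ball_zero_iff] at h1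
  rw [mem_sphere_zero_iff_norm] at hh
  linarith

/-- An `m`-cell in the boundary sphere of an `(m + 1)`-cell is a neighbourhood, within that
boundary, of each point outside its own boundary. -/
theorem mem_nhdsWithin_cellBoundary {m : ℕ} {D C : Set X} (hD : IsCell (m + 1) D)
    (hC : IsCell m C) (hCD : C ⊆ cellBoundary (m + 1) D) {x : X} (hx : x ∈ C)
    (hxb : x ∉ cellBoundary m C) : C ∈ nhdsWithin x (cellBoundary (m + 1) D) := by
  obtain ⟨g⟩ := hD
  obtain ⟨h⟩ := hC
  have hbD : cellBoundary (m + 1) D ⊆ D := fun y hy => hy.1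
  have hlt : (h ⟨x, hx⟩ : EuclideanSpace ℝ (Fin m)) ∈ ball 0 1 := by
    have hle : ‖(h ⟨x, hx⟩ : EuclideanSpace ℝ (Fin m))‖ ≤ 1 := mem_closedBall_zero_iff.1 (h ⟨x, hx⟩).2
    rw [mem_ball_zero_iff]
    refine lt_of_le_of_ne hle fun heq => hxb ⟨hx, h, by simpa using heq⟩
  let S := sphere (0 : EuclideanSpace ℝ (Fin (m + 1))) 1
  let γ : cellBoundary (m + 1) D → S := fun y =>
    ⟨g (inclusion hbD y), mem_sphere_zero_iff_norm.2
      (norm_eq_one_of_mem_cellBoundary y.2 g (hbD y.2))⟩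
  have hγ : Continuous γ := by fun_prop
  have hγi : Function.Injective γ := fun y z hyz =>
    inclusion_injective hbD (g.injective (Subtype.ext (congrArg (fun p : S => p.1) hyz)))
  let φ : ball (0 : EuclideanSpace ℝ (Fin m)) 1 → S := fun u =>
    γ (inclusion hCD (h.symm (inclusion ball_subset_closedBall u)))
  have ho : IsOpen (range φ) := isOpen_range_of_chartedSpace isOpen_ball
    (by fun_prop) (hγi.comp ((inclusion_injective hCD).comp (h.symm.injective.comp
      (inclusion_injective _))))
  have hmem : γ ⁻¹' range φ ∈ nhds (⟨x, hCD hx⟩ : cellBoundary (m + 1) D) := by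
    refine (ho.preimage hγ).mem_nhds ⟨⟨_, hlt⟩, ?_⟩
    exact congrArg (fun y => γ (inclusion hCD y)) (h.symm_apply_apply ⟨x, hx⟩)
  rw [nhds_subtype_eq_comap] at hmem
  obtain ⟨V, hV, hVs⟩ := hmem
  refine mem_nhdsWithin_iff_exists_mem_nhds_inter.2 ⟨V, hV, fun y ⟨hyV, hyb⟩ => ?_⟩
  obtain ⟨u, hu⟩ := hVs (show (⟨y, hyb⟩ : cellBoundary (m + 1) D) ∈ Subtype.val ⁻¹' V from hyV)
  have h1 := congrArg Subtype.val (hγi hu)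
  rw [← show _ = y from h1]
  exact (h.symm _).2

/-- A cell of lower dimension has empty interior relative to a cell that contains it. -/
theorem not_mem_nhdsWithin_of_isCell {m k : ℕ} (hk : k < m) {C A : Set X} (hC : IsCell m C)
    (hA : IsCell k A) {x : X} (hx : x ∈ C) : A ∉ nhdsWithin x C := by
  intro hmem
  obtain ⟨h⟩ := hC
  obtain ⟨a⟩ := hA
  have h1 : (fun u => ((h.symm u : C) : X)) ⁻¹' A ∈ nhds (h ⟨x, hx⟩) := by
    have hc : ContinuousAt h.symm (h ⟨x, hx⟩) := h.symm.continuous.continuousAt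
    have h2 : Subtype.val ⁻¹' A ∈ nhds (h.symm (h ⟨x, hx⟩)) := by
      rw [h.symm_apply_apply, nhds_subtype_eq_comap]
      obtain ⟨V, hV, hVA⟩ := mem_nhdsWithin_iff_exists_mem_nhds_inter.1 hmem
      exact ⟨V, hV, fun y hy => hVA ⟨hy, y.2⟩⟩
    exact hc h2
  rw [nhds_subtype_eq_comap] at h1
  obtain ⟨V, hV, hVs⟩ := h1
  obtain ⟨W, hWV, hWo, hxW⟩ := _root_.mem_nhds_iff.1 hV
  have hxcl : (h ⟨x, hx⟩ : EuclideanSpace ℝ (Fin m)) ∈ closure (ball 0 1) := by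
    rw [closure_ball _ one_ne_zero]
    exact (h ⟨x, hx⟩).2
  let U := W ∩ ball (0 : EuclideanSpace ℝ (Fin m)) 1
  have hUne : U.Nonempty := mem_closure_iff.1 hxcl W hWo hxW
  have hUB : U ⊆ closedBall 0 1 := inter_subset_right.trans ball_subset_closedBall
  let φ : U → EuclideanSpace ℝ (Fin k) := fun u =>
    a ⟨h.symm (inclusion hUB u), @hVs (inclusion hUB u) (hWV u.2.1)⟩
  have hle := finrank_le_of_continuous_injective (hWo.inter isOpen_ball) hUne (φ := φ)
    (by fun_prop) (fun u v huv => by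
      have h2 := congrArg Subtype.val (a.injective (Subtype.val_injective huv))
      exact inclusion_injective hUB (h.symm.injective (Subtype.val_injective h2)))
  simp only [finrank_euclideanSpace_fin] at hle
  omega

end Cells

/-! ### The collection cut out on one member -/

theorem theorem2p1 {X : Type*} [TopologicalSpace X] {ι : Type*} (n : ℕ) (hn : 1 ≤ n)
    (D : ι → Set X) (hD : IsLCL n D) (i₀ : ι) :
    IsLCL (n - 1) (fun i : MeetingIndex D i₀ => D i₀ ∩ D i.1) ∧
      IsomorphicCollections (fun i : MeetingIndex D i₀ => D i.1)
        (fun i : MeetingIndex D i₀ => D i₀ ∩ D i.1) := by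
  classical
  obtain ⟨m, rfl⟩ : ∃ m, n = m + 1 := ⟨n - 1, by omega⟩
  rw [Nat.add_sub_cancel]
  have hfin := hD.finite
  -- the family `J` together with `i₀`
  let J' : Finset (MeetingIndex D i₀) → Finset ι := fun J =>
    insert i₀ (J.map (Function.Embedding.subtype _))
  have hcard (J : Finset (MeetingIndex D i₀)) : (J' J).card = J.card + 1 := by
    rw [Finset.card_insert_of_notMem, Finset.card_map]
    simp
  have hinter (J : Finset (MeetingIndex D i₀)) (hJ : J.Nonempty) :
      ⋂ i ∈ J' J, D i = ⋂ i ∈ J, (D i₀ ∩ D i.1) := by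
    obtain ⟨j, hj⟩ := hJ
    ext x
    simp only [J', Finset.mem_insert, Finset.mem_map, Function.Embedding.subtype_apply, mem_iInter,
      mem_inter_iff, forall_eq_or_imp, forall_exists_index, and_imp, forall_apply_eq_imp_iff₂]
    exact ⟨fun h i hi => ⟨h.1, h.2 i hi⟩, fun h => ⟨(h j hj).1, fun i hi => (h i hi).2⟩⟩
  have hLC (J : Finset (MeetingIndex D i₀)) (hJ : J.Nonempty)
      (hp : ∀ i ∈ J, ∀ k ∈ J, (D i.1 ∩ D k.1).Nonempty) :
      (⋂ i ∈ J, (D i₀ ∩ D i.1)).Nonempty := by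
    rw [← hinter J hJ]
    refine hD.locallyCentered _ (by rw [hcard]; have := hJ.card_pos; omega) ?_
    have h00 : (D i₀ ∩ D i₀).Nonempty := by
      obtain ⟨j, -⟩ := hJ
      rw [inter_self]
      exact j.2.2.left
    intro i hi k hk
    simp only [J', Finset.mem_insert, Finset.mem_map, Function.Embedding.subtype_apply] at hi hk
    obtain rfl | ⟨i, hi, rfl⟩ := hi <;> obtain rfl | ⟨k, hk, rfl⟩ := hk
    · exact h00
    · exact k.2.2
    · rw [inter_comm]; exact i.2.2
    · exact hp i hi k hk
  have hcell (J : Finset (MeetingIndex D i₀)) (hJ : J.Nonempty)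
      (hne : (⋂ i ∈ J, (D i₀ ∩ D i.1)).Nonempty) :
      (⋂ i ∈ J, (D i₀ ∩ D i.1)) ⊆ cellBoundary (m + 1) (D i₀) ∧
        ∃ k, k + J.card = m + 1 ∧ IsCell k (⋂ i ∈ J, (D i₀ ∩ D i.1)) := by
    rw [← hinter J hJ] at hne ⊢
    obtain ⟨h1, k, hk, hkc⟩ :=
      hD.locallyLump (J' J) (by rw [hcard]; have := hJ.card_pos; omega) hne
    refine ⟨?_, k, by rw [hcard] at hk; omega, hkc⟩
    rw [h1]
    exact biInter_subset_of_mem (Finset.mem_coe.2 (Finset.mem_insert_self _ _))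
  have hone (i : MeetingIndex D i₀) : D i₀ ∩ D i.1 ⊆ cellBoundary (m + 1) (D i₀) ∧
      IsCell m (D i₀ ∩ D i.1) := by
    have h := hcell {i} (Finset.singleton_nonempty i) (by simpa using i.2.2)
    simp only [Finset.mem_singleton, iInter_iInter_eq_left, Finset.card_singleton] at h
    obtain ⟨h1, k, hk, hkc⟩ := h
    obtain rfl : k = m := by omega
    exact ⟨h1, hkc⟩
  refine ⟨⟨inferInstance, fun i => (hone i).2, fun J hJ hp => hLC J
    (Finset.card_pos.1 (by omega)) fun i hi k hk => (hp i hi k hk).mono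
      (inter_subset_inter inter_subset_right inter_subset_right), fun J hJ hne => ?_⟩,
    fun J hJ => ⟨fun h => hLC J hJ fun i hi k hk => ?_, fun h => ?_⟩⟩
  · have hJne : J.Nonempty := Finset.card_pos.1 (by omega)
    refine ⟨Subset.antisymm (subset_iInter₂ fun i hi x hx => ?_)
      (iInter₂_mono fun i _ x hx => hx.1), (hcell J hJne hne).2⟩
    by_contra hxb
    obtain ⟨j, hj, hji⟩ := Finset.exists_mem_ne (by omega : 1 < J.card) i
    simp only [mem_iInter] at hx
    have hnhds := nhdsWithin_mono x (hone j).1 (mem_nhdsWithin_cellBoundary (hD.isCell i₀)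
      (hone i).2 (hone i).1 (hx i hi) hxb)
    -- so near `x` the `m`-cell `D i₀ ∩ D j` lies in a cell of dimension `m - 1`
    have hpair : (⋂ l ∈ ({i, j} : Finset (MeetingIndex D i₀)), (D i₀ ∩ D l.1)) =
        (D i₀ ∩ D i.1) ∩ (D i₀ ∩ D j.1) := by
      simp
    obtain ⟨-, k, hk, hkc⟩ := hcell {i, j} (by simp)
      (by rw [hpair]; exact ⟨x, hx i hi, hx j hj⟩)
    rw [Finset.card_pair hji.symm] at hk
    rw [hpair] at hkc
    exact not_mem_nhdsWithin_of_isCell (by omega : k < m) (hone j).2 hkc (hx j hj)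
      (Filter.inter_mem hnhds self_mem_nhdsWithin)
  · exact h.mono fun x hx => ⟨mem_iInter₂.1 hx i hi, mem_iInter₂.1 hx k hk⟩
  · exact h.mono (iInter₂_mono fun i _ => inter_subset_right)
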